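/- Let $\mathbb F$ be an algebraically closed field of characteristic $p\neq 2$ (so $p=0$ or $p\ge 3$ is an odd prime). Put $\mathbb I=\mathbb Z_{\ge 0}$ if $p=0$ and $\mathbb I=\{0,1,\dots,\frac{p-1}{2}\}$ if $p\ge 3$, and $q(i)=i(i+1)\in\mathbb F$ for $i\in\mathbb I$. For $n\ge 0$ let $\mathfrak H^{\mathfrak c}_n$ be the affine Hecke-Clifford algebra: the $\mathbb F$-superalgebra generated by even generators $s_1,\dots,s_{n-1},x_1,\dots,x_n$ and odd generators $c_1,\dots,c_n$ subject to the relations \begin{gather*} s_i^2=1,\quad s_is_j=s_js_i\ (|i-j|>1),\quad s_is_{i+1}s_i=s_{i+1}s_is_{i+1},\\ x_ix_j=x_jx_i,\quad c_i^2=1,\quad c_ic_j=-c_jc_i\ (i\ne j),\\ s_ix_i=x_{i+1}s_i-(1+c_ic_{i+1}),\quad s_ix_j=x_js_i\ (j\ne i,i+1),\\ s_ic_i=c_{i+1}s_i,\quad s_ic_{i+1}=c_is_i,\quad s_ic_j=c_js_i\ (j\neq i,i+1),\\ x_ic_i=-c_ix_i,\quad x_ic_j=c_jx_i\ (i\neq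 j). \end{gather*} Modules are $\mathbb Z_2$-graded left modules, and a module is irreducible if it is nonzero and its only $\mathbb Z_2$-graded submodules are $0$ and itself. A module is integral if it is finite dimensional and all eigenvalues of $x_1^2,\dots,x_n^2$ on it are of the form $q(i)$ with $i\in\mathbb I$. For $\underline i=(i_1,\dots,i_n)\in\mathbb I^n$ let $M_{\underline i}=\{z\in M : (x_k^2-q(i_k))^Nz=0 \text{ for } N\gg0,\ 1\le k\le n\}$; $\underline i$ is a weight of $M$ if $M_{\underline i}\neq 0$. The transposition $s_k=(k,k+1)$ acts on $\mathbb I^n$ by exchanging the $k$-th and $(k+1)$-st entries. **Proposition.** Let $M$ be an irreducible integral $\mathfrak H^{\mathfrak c}_n$-module on which $x_1^2,\dots,x_n^2$ act semisimply, and let $\underline i\in\mathbb I^n$ be a weight of $M$. Then: 1. If $1\le k\le n-1$ and $i_k\neq i_{k+1}\pm 1$, then $s_k\cdot\underline i$ is a weight of $M$. 2. If $i_k=i_{k+1}$ for some $1\le k\le n-1$, then $i_k=i_{k+1}=0$. 3. There is no $1\le k\le n-2$ with $i_k=i_{k+1}=i_{k+2}$. 4. If $i_k=i_{k+2}$ for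 some $1\le k\le n-2$, then: (a) if $p=0$, $i_k=i_{k+2}=0$; (b) if $p\ge 3$, either $i_k=i_{k+2}=\frac{p-3}{2}$ and $i_{k+1}=\frac{p-1}{2}$, or $i_k=i_{k+2}=0$. -/

import Mathlib

namespace HeckeClifford

/-- The generators `s_1, …, s_{n-1}`, `x_1, …, x_n`, `c_1, …, c_n`, numbered from `0`:
`s k _` is the simple transposition exchanging positions `k` and `k + 1`. -/
inductive Gen (n : ℕ) : Type
  | s (k : ℕ) (h : k + 1 < n) : Gen n
  | x (k : Fin n) : Gen n
  | c (k : Fin n) : Gen n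

/-- The parity of a generator: `s` and `x` are even, `c` is odd. -/
def Gen.parity {n : ℕ} : Gen n → ZMod 2
  | .s _ _ => 0
  | .x _ => 0
  | .c _ => 1

section Relations

variable (F : Type*) [Field F] {n : ℕ}

/-- `s_k` in the free algebra. -/
def fs (k : ℕ) (h : k + 1 < n) : FreeAlgebra F (Gen n) := FreeAlgebra.ι F (Gen.s k h)

/-- `x_k` in the free algebra. -/
def fx (k : Fin n) : FreeAlgebra F (Gen n) := FreeAlgebra.ι F (Gen.x k)

/-- `c_k` in the free algebra. -/
def fc (k : Fin n) : FreeAlgebra F (Gen n) := FreeAlgebra.ι F (Gen.c k)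

/-- The defining relations of the affine Hecke-Clifford algebra. -/
inductive Rel : FreeAlgebra F (Gen n) → FreeAlgebra F (Gen n) → Prop
  | s_sq (k : ℕ) (h : k + 1 < n) : Rel (fs F k h * fs F k h) 1
  | s_comm (k l : ℕ) (hk : k + 1 < n) (hl : l + 1 < n) (hkl : k + 1 < l ∨ l + 1 < k) :
      Rel (fs F k hk * fs F l hl) (fs F l hl * fs F k hk)
  | s_braid (k : ℕ) (h : k + 2 < n) :
      Rel (fs F k (by omega) * fs F (k + 1) h * fs F k (by omega))
        (fs F (k + 1) h * fs F k (by omega) * fs F (k + 1) h)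
  | x_comm (k l : Fin n) : Rel (fx F k * fx F l) (fx F l * fx F k)
  | c_sq (k : Fin n) : Rel (fc F k * fc F k) 1
  | c_anti (k l : Fin n) (hkl : k ≠ l) : Rel (fc F k * fc F l) (-(fc F l * fc F k))
  | s_x (k : ℕ) (h : k + 1 < n) :
      Rel (fs F k h * fx F ⟨k, by omega⟩)
        (fx F ⟨k + 1, h⟩ * fs F k h - (1 + fc F ⟨k, by omega⟩ * fc F ⟨k + 1, h⟩))
  | s_x_far (k : ℕ) (h : k + 1 < n) (j : Fin n) (h₁ : (j : ℕ) ≠ k) (h₂ : (j : ℕ) ≠ k + 1) :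
      Rel (fs F k h * fx F j) (fx F j * fs F k h)
  | s_c_left (k : ℕ) (h : k + 1 < n) :
      Rel (fs F k h * fc F ⟨k, by omega⟩) (fc F ⟨k + 1, h⟩ * fs F k h)
  | s_c_right (k : ℕ) (h : k + 1 < n) :
      Rel (fs F k h * fc F ⟨k + 1, h⟩) (fc F ⟨k, by omega⟩ * fs F k h)
  | s_c_far (k : ℕ) (h : k + 1 < n) (j : Fin n) (h₁ : (j : ℕ) ≠ k) (h₂ : (j : ℕ) ≠ k + 1) :
      Rel (fs F k h * fc F j) (fc F j * fs F k h)
  | x_c_same (k : Fin n) : Rel (fx F k * fc F k) (-(fc F k * fx F k))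
  | x_c (k l : Fin n) (hkl : k ≠ l) : Rel (fx F k * fc F l) (fc F l * fx F k)

end Relations

/-- The (degenerate) affine Hecke-Clifford algebra of rank `n` over `F`. -/
def Alg (F : Type*) [Field F] (n : ℕ) : Type _ := RingQuot (Rel F (n := n))

noncomputable instance (F : Type*) [Field F] (n : ℕ) : Ring (Alg F n) :=
  inferInstanceAs (Ring (RingQuot (Rel F (n := n))))

noncomputable instance (F : Type*) [Field F] (n : ℕ) : Algebra F (Alg F n) :=
  inferInstanceAs (Algebra F (RingQuot (Rel F (n := n))))

/-- The image of a generator in the affine Hecke-Clifford algebra. -/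
noncomputable def gen (F : Type*) [Field F] {n : ℕ} (g : Gen n) : Alg F n :=
  RingQuot.mkAlgHom F (Rel F (n := n)) (FreeAlgebra.ι F g)

/-- The element `x_k` of the affine Hecke-Clifford algebra. -/
noncomputable def x (F : Type*) [Field F] {n : ℕ} (k : Fin n) : Alg F n := gen F (Gen.x k)

/-- The `ℤ/2`-grading of the affine Hecke-Clifford algebra: the component of degree `j` is spanned
by the words in the generators whose parities add up to `j`. -/
noncomputable def part (F : Type*) [Field F] (n : ℕ) (j : ZMod 2) : Submodule F (Alg F n) :=
  Submodule.span F {a | ∃ l : List (Gen n), (l.map Gen.parity).sum = j ∧ a = (l.map (gen F)).prod}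

/-- The index set `𝕀` in characteristic `p ≠ 2`: all of `ℕ` if `p = 0`, and
`{0, 1, …, (p - 1) / 2}` otherwise. -/
def I (p : ℕ) : Set ℕ := {i | p = 0 ∨ i ≤ (p - 1) / 2}

/-- `q(i) = i (i + 1)` as an element of `F`. -/
def q (F : Type*) [Field F] (i : ℕ) : F := (i : F) * ((i : F) + 1)

section Modules

variable {F : Type*} [Field F] (p : ℕ) {n : ℕ} (M : Type*) [AddCommGroup M] [Module F M]
  [Module (Alg F n) M] [IsScalarTower F (Alg F n) M]

/-- The `F`-linear operator on `M` given by the action of `x_k ^ 2`. -/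
noncomputable def xSq (k : Fin n) : Module.End F M := Algebra.lsmul F F M (x F k ^ 2)

/-- `M` is integral: it is finite dimensional, and every eigenvalue of every `x_k ^ 2` on `M` is of
the form `q(i)` with `i ∈ 𝕀`. -/
def IsIntegral : Prop :=
  FiniteDimensional F M ∧
    ∀ (k : Fin n) (a : F), (xSq (F := F) M k).HasEigenvalue a → ∃ i ∈ I p, a = q F i

/-- The weight space `M_i`, the joint generalized eigenspace of the `x_k ^ 2` for the
eigenvalues `q(i_k)`. -/
noncomputable def weightSpace (i : Fin n → ℕ) : Submodule F M :=
  ⨅ k : Fin n, (xSq (F := F) M k).maxGenEigenspace (q F (i k))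

/-- `i ∈ 𝕀 ^ n` is a weight of `M` if `M_i ≠ 0`. -/
def IsWeight (i : Fin n → ℕ) : Prop :=
  (∀ k, i k ∈ I p) ∧ weightSpace (F := F) M i ≠ ⊥

/-- A `ℤ/2`-graded module over the affine Hecke-Clifford superalgebra is irreducible if it is
nonzero and has no `ℤ/2`-graded submodules other than `0` and itself. -/
def IsIrreducible (F : Type*) [Field F] (n : ℕ) {M : Type*} [AddCommGroup M] [Module F M]
    [Module (Alg F n) M] (ℳ : ZMod 2 → Submodule F M) [DirectSum.Decomposition ℳ] : Prop :=
  Nontrivial M ∧ ∀ N : Submodule (Alg F n) M, N.IsHomogeneous ℳ → N = ⊥ ∨ N = ⊤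

end Modules

end HeckeClifford

/-! Semisimplicity turns weights into joint eigenvectors z of the squares x_k². Write a, b for the
eigenvalues of x², y² on two adjacent strands and A for the correction term `corr`, so that A² =
2(x² + y²) and sA = As. The intertwiner (a - b)s + A carries z to the swapped weight. If it kills z,
then (a - b)² = 2(a + b), which for residues means equal or adjacent. This is claim 1.

If a = b, then Az = (y² - a)sz is itself killed by y² - a, so Az = 0 by semisimplicity; A² = 4a then
forces a = 0, which is claim 2. For three equal residues, the vanishing of the correction terms on z
and on the swapped vector is incompatible with the Clifford relations.

If i_k = i_{k+2} ≠ 0, both intertwiners vanish on the whole eigenspace: otherwise a swap would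
create two equal nonzero neighbours. So s and t act there as multiples of A and B, and the braid
relation yields ABA + BAB = 0. A direct computation gives ABA + BAB = (2a + 6b)C, with C the
correction term of the outer strands. Cz = 0 would again force i_k = 0, so 2a + 6b = 0, whose only
solution among adjacent residues is the exceptional one (`corr_outer_smul_eq_zero`,
`eq_of_two_q_add_six_q`). -/

namespace HeckeClifford

/-! ### Two adjacent strands, as identities on vectors. -/

section Strands

variable {F R V : Type*} [Field F] [Ring R] [AddCommGroup V] [Module R V]

/-- Relations between the polynomial and Clifford generators of two strands. -/
structure IsCliffordPair (x y c d : R) : Prop where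
  yx : y * x = x * y
  cc : c * c = 1
  dd : d * d = 1
  dc : d * c = -(c * d)
  xc : x * c = -(c * x)
  yd : y * d = -(d * y)
  xd : x * d = d * x
  yc : y * c = c * y

/-- Relations between the generators of two adjacent strands. -/
structure IsStrandPair (s x y c d : R) : Prop extends IsCliffordPair x y c d where
  ss : s * s = 1
  sx : s * x = y * s - (1 + c * d)
  sc : s * c = d * s
  sd : s * d = c * s

/-- The correction term `(x + y) + c d (x - y)` of the intertwining element. -/
def corr (x y c d : R) : R := (x + y) + c * d * (x - y)

theorem corr_smul (x y c d : R) (v : V) :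
    corr x y c d • v = x • v + y • v + c • d • (x • v - y • v) := by
  simp only [corr, add_smul, mul_smul, sub_smul]

namespace IsCliffordPair

variable {x y c d : R} (h : IsCliffordPair x y c d)
include h

theorem yx_smul (v : V) : y • x • v = x • y • v := by rw [← mul_smul, h.yx, mul_smul]
theorem cc_smul (v : V) : c • c • v = v := by rw [← mul_smul, h.cc, one_smul]
theorem dd_smul (v : V) : d • d • v = v := by rw [← mul_smul, h.dd, one_smul]
theorem dc_smul (v : V) : d • c • v = -(c • d • v) := by
  rw [← mul_smul, h.dc, neg_smul, mul_smul]
theorem xc_smul (v : V) : x • c • v = -(c • x • v) := by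
  rw [← mul_smul, h.xc, neg_smul, mul_smul]
theorem yd_smul (v : V) : y • d • v = -(d • y • v) := by
  rw [← mul_smul, h.yd, neg_smul, mul_smul]
theorem xd_smul (v : V) : x • d • v = d • x • v := by rw [← mul_smul, h.xd, mul_smul]
theorem yc_smul (v : V) : y • c • v = c • y • v := by rw [← mul_smul, h.yc, mul_smul]

theorem xx_corr_smul (v : V) : x • x • corr x y c d • v = corr x y c d • x • x • v := by
  simp only [corr_smul, smul_sub, smul_add, h.xc_smul, h.xd_smul, smul_neg, neg_neg, h.yx_smul]

theorem yy_corr_smul (v : V) : y • y • corr x y c d • v = corr x y c d • y • y • v := by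
  simp only [corr_smul, smul_sub, smul_add, h.yc_smul, h.yd_smul, smul_neg, neg_neg, h.yx_smul]

theorem corr_corr_smul (v : V) :
    corr x y c d • corr x y c d • v = (x • x • v + y • y • v) + (x • x • v + y • y • v) := by
  simp only [corr_smul, smul_sub, smul_add, h.xc_smul, h.xd_smul, h.yc_smul, h.yd_smul, h.dc_smul,
    smul_neg, neg_neg, h.cc_smul, h.dd_smul, h.yx_smul]
  abel

variable [Module F V]

/-- Since (cd)² = -1, multiplying the correction term by 1 - cd gives 2(x - cdy). -/
theorem smul_eq_of_corr_smul_eq_zero (h2 : (2 : F) ≠ 0) {v : V}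
    (hv : corr x y c d • v = 0) : x • v = c • d • y • v := by
  have h1 : corr x y c d • v - c • d • corr x y c d • v = (2 : F) • (x • v - c • d • y • v) := by
    simp only [corr_smul, smul_sub, smul_add, h.dc_smul, h.cc_smul, h.dd_smul, smul_neg, two_smul]
    abel
  rw [hv, smul_zero, smul_zero, sub_zero, eq_comm, smul_eq_zero] at h1
  exact sub_eq_zero.1 (h1.resolve_left h2)

theorem corr_corr_smul_of_eigen {a b : F} {v : V} (hx : x • x • v = a • v)
    (hy : y • y • v = b • v) :
    corr x y c d • corr x y c d • v = (2 * (a + b)) • v := by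
  rw [h.corr_corr_smul, hx, hy]
  module

end IsCliffordPair

namespace IsStrandPair

variable {s x y c d : R} (h : IsStrandPair s x y c d)
include h

theorem ss_smul (v : V) : s • s • v = v := by rw [← mul_smul, h.ss, one_smul]
theorem sx_smul (v : V) : s • x • v = y • s • v - (v + c • d • v) := by
  rw [← mul_smul, h.sx, sub_smul, add_smul, mul_smul, mul_smul, one_smul]
theorem sc_smul (v : V) : s • c • v = d • s • v := by rw [← mul_smul, h.sc, mul_smul]
theorem sd_smul (v : V) : s • d • v = c • s • v := by rw [← mul_smul, h.sd, mul_smul]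

theorem sy_smul (v : V) : s • y • v = x • s • v + (v - c • d • v) := by
  have h1 := h.sx_smul (s • v)
  rw [h.ss_smul] at h1
  have h2 : y • v = s • x • s • v + (s • v + c • d • s • v) := by rw [h1]; abel
  rw [h2]
  simp only [smul_add, h.ss_smul, h.sc_smul, h.sd_smul, h.dc_smul]
  abel

theorem s_xx_smul (v : V) : s • x • x • v = y • y • s • v - corr x y c d • v := by
  simp only [corr_smul, h.sx_smul, smul_sub, smul_add, h.yc_smul, h.yd_smul, smul_neg]
  abel

theorem s_yy_smul (v : V) : s • y • y • v = x • x • s • v + corr x y c d • v := by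
  simp only [corr_smul, h.sy_smul, smul_sub, smul_add, h.xc_smul, h.xd_smul]
  abel

theorem s_corr_smul (v : V) : s • corr x y c d • v = corr x y c d • s • v := by
  simp only [corr_smul, smul_sub, smul_add, h.sx_smul, h.sy_smul, h.sc_smul, h.sd_smul, h.dc_smul,
    h.cc_smul, h.dd_smul]
  abel

variable [Algebra F R] [Module F V] [IsScalarTower F R V]

theorem eigen_intertwiner {a b : F} {z : V} (hx : x • x • z = a • z) (hy : y • y • z = b • z) :
    x • x • ((a - b) • s • z + corr x y c d • z) = b • ((a - b) • s • z + corr x y c d • z) ∧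
    y • y • ((a - b) • s • z + corr x y c d • z) = a • ((a - b) • s • z + corr x y c d • z) := by
  have sc : ∀ (r : R) (f : F) (v : V), r • f • v = f • r • v := fun r f v => smul_comm r f v
  have h1 : x • x • s • z = b • s • z - corr x y c d • z := by
    have := h.s_yy_smul z
    rw [hy, sc] at this
    rw [this]; abel
  have h2 : y • y • s • z = a • s • z + corr x y c d • z := by
    have := h.s_xx_smul z
    rw [hx, sc] at this
    rw [this]; abel
  constructor
  · rw [smul_add, smul_add, h.xx_corr_smul, hx, sc, sc, sc, h1]
    generalize s • z = u, corr x y c d • z = v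
    module
  · rw [smul_add, smul_add, h.yy_corr_smul, hy, sc, sc, sc, h2]
    generalize s • z = u, corr x y c d • z = v
    module

/-- Here `corr` acts on z as -(a - b)s. As it commutes with s and s² = 1, its square is (a - b)² on
z, to be compared with 2(x² + y²). -/
theorem eq_of_intertwiner_eq_zero {a b : F} {z : V} (hz : z ≠ 0) (hx : x • x • z = a • z)
    (hy : y • y • z = b • z) (h0 : (a - b) • s • z + corr x y c d • z = 0) :
    (a - b) ^ 2 = 2 * (a + b) := by
  have sc : ∀ (r : R) (f : F) (v : V), r • f • v = f • r • v := fun r f v => smul_comm r f v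
  have h1 : corr x y c d • z = -((a - b) • s • z) := by
    rw [eq_neg_iff_add_eq_zero, add_comm, h0]
  have h2 := h.corr_corr_smul_of_eigen hx hy
  rw [h1, smul_neg, sc, ← h.s_corr_smul, h1, smul_neg, sc, h.ss_smul, smul_neg, neg_neg,
    smul_smul, ← sub_eq_zero, ← sub_smul, smul_eq_zero] at h2
  linear_combination h2.resolve_right hz

/-- `hss` is what semisimplicity of y² supplies: ker (y² - a)² = ker (y² - a). It is applied to sz,
for which (y² - a)sz is the correction term. -/
theorem corr_smul_eq_zero {a : F} (hss : ∀ v : V, y • y • (y • y • v - a • v) =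
    a • (y • y • v - a • v) → y • y • v = a • v) {z : V} (hx : x • x • z = a • z)
    (hy : y • y • z = a • z) : corr x y c d • z = 0 := by
  have sc : ∀ (r : R) (f : F) (v : V), r • f • v = f • r • v := fun r f v => smul_comm r f v
  have h2 : y • y • s • z - a • s • z = corr x y c d • z := by
    have := h.s_xx_smul z
    rw [hx, sc] at this
    rw [this]; abel
  have h3 := hss (s • z) (by rw [h2, h.yy_corr_smul, hy, sc])
  rw [← h2, h3, sub_self]

theorem eigen_s_smul {a : F} {z : V} (hx : x • x • z = a • z) (hy : y • y • z = a • z)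
    (h0 : corr x y c d • z = 0) : x • x • s • z = a • s • z ∧ y • y • s • z = a • s • z := by
  have sc : ∀ (r : R) (f : F) (v : V), r • f • v = f • r • v := fun r f v => smul_comm r f v
  have h1 := h.s_xx_smul z
  have h2 := h.s_yy_smul z
  rw [h0, hx, sub_zero, sc] at h1
  rw [h0, hy, add_zero, sc] at h2
  exact ⟨h2.symm, h1.symm⟩

end IsStrandPair

/-! ### Three strands and the braid relation. -/

/-- Relations between three consecutive strands. -/
structure IsStrandTriple (s t x y w c d e : R) : Prop where
  left : IsStrandPair s x y c d
  right : IsStrandPair t y w d e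
  braid : s * t * s = t * s * t
  tx : t * x = x * t
  tc : t * c = c * t
  wx : w * x = x * w
  ec : e * c = -(c * e)
  xe : x * e = e * x
  wc : w * c = c * w

namespace IsStrandTriple

variable {s t x y w c d e : R} (h : IsStrandTriple s t x y w c d e)
include h

theorem wx_smul (v : V) : w • x • v = x • w • v := by rw [← mul_smul, h.wx, mul_smul]
theorem xe_smul (v : V) : x • e • v = e • x • v := by rw [← mul_smul, h.xe, mul_smul]
theorem wc_smul (v : V) : w • c • v = c • w • v := by rw [← mul_smul, h.wc, mul_smul]
theorem tx_smul (v : V) : t • x • v = x • t • v := by rw [← mul_smul, h.tx, mul_smul]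
theorem tc_smul (v : V) : t • c • v = c • t • v := by rw [← mul_smul, h.tc, mul_smul]
theorem ec_smul (v : V) : e • c • v = -(c • e • v) := by
  rw [← mul_smul, h.ec, neg_smul, mul_smul]

variable [Module F V]

/-- Evaluating x(tz) = t(xz) in two ways leaves cd(z - dez) = 0, hence dz = ez. Then dez = z and edz
= z, while de = -ed, so 2z = 0. -/
theorem eq_zero_of_smul_eq (h2 : (2 : F) ≠ 0) {z : V} (h1 : x • z = c • d • y • z)
    (h3 : y • z = d • e • w • z) (h4 : x • t • z = c • d • y • t • z) : z = 0 := by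
  have l := h.left
  have r := h.right
  have h5 : y • t • z = t • w • z - (z - d • e • z) := by rw [r.sy_smul]; abel
  rw [h5, ← h.tx_smul, h1, h3] at h4
  simp only [l.dd_smul, smul_sub, h.tc_smul, r.sd_smul] at h4
  rw [← r.sd_smul, eq_comm, sub_eq_self, sub_eq_zero] at h4
  have h6 : d • z = e • z := by
    have := congrArg (fun v => c • v) h4
    simpa only [l.cc_smul] using this
  have h7 : z = d • e • z := by rw [← h6, r.cc_smul]
  have h8 : z = -(d • e • z) := by rw [← r.dc_smul, h6, r.dd_smul]
  have h9 : (2 : F) • z = 0 := by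
    rw [two_smul]
    nth_rewrite 1 [h7]
    nth_rewrite 2 [h8]
    abel
  exact (smul_eq_zero.1 h9).resolve_left h2

variable [Algebra F R] [IsScalarTower F R V]

/-- Each word is moved to normal form, Clifford generators to the left of x, y, w, and squares are
replaced by eigenvalues; the outer strands share the eigenvalue a. -/
theorem corr_braid_smul {a b : F} (z : V) (hx : x • x • z = a • z) (hy : y • y • z = b • z)
    (hw : w • w • z = a • z) :
    corr x y c d • corr y w d e • corr x y c d • z + corr y w d e • corr x y c d • corr y w d e • z
      = (2 * a + 6 * b) • corr x w c e • z := by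
  have sc : ∀ (r : R) (f : F) (v : V), r • f • v = f • r • v := fun r f v => (smul_comm r f v)
  have l := h.left
  have r := h.right
  have h1 : x • x • y • z = a • y • z := by
    rw [← l.yx_smul, ← l.yx_smul, hx, sc]
  have h2 : x • x • w • z = a • w • z := by
    rw [← h.wx_smul, ← h.wx_smul, hx, sc]
  have h3 : y • y • w • z = b • w • z := by
    rw [← r.yx_smul, ← r.yx_smul, hy, sc]
  simp only [corr_smul, smul_sub, smul_add, smul_neg, neg_neg, sc, l.xc_smul, l.xd_smul, l.yc_smul,
    l.yd_smul, l.dc_smul, l.cc_smul, l.dd_smul, l.yx_smul, r.yx_smul, r.xd_smul,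
    r.yc_smul, r.yd_smul, r.dc_smul, r.dd_smul, h.wx_smul, h.xe_smul, h.wc_smul, h.ec_smul,
    hy, hw, h1, h2, h3]
  -- Writing the action of `R` through linear maps leaves `module` only scalars from `F`.
  have hL : ∀ (u : R) (v : V), u • v = Algebra.lsmul F F V u v := fun _ _ => rfl
  simp only [hL]
  module

/-- `P` stands for membership in the joint eigenspace. Its stability under the correction terms lets
`hA` and `hB` be used inside words of length three. The two words become (a - b)³sts and -(a -
b)³tst, which cancel by the braid relation. -/
theorem corr_outer_smul_eq_zero {a b : F} {P : V → Prop}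
    (hPA : ∀ v, P v → P (corr x y c d • v)) (hPB : ∀ v, P v → P (corr y w d e • v))
    (hA : ∀ v, P v → (a - b) • s • v + corr x y c d • v = 0)
    (hB : ∀ v, P v → (b - a) • t • v + corr y w d e • v = 0)
    {z : V} (hz : P z) (hx : x • x • z = a • z) (hy : y • y • z = b • z) (hw : w • w • z = a • z) :
    (2 * a + 6 * b) • corr x w c e • z = 0 := by
  have sc : ∀ (r : R) (f : F) (v : V), r • f • v = f • r • v := fun r f v => smul_comm r f v
  have hA' : ∀ v, P v → corr x y c d • v = (b - a) • s • v := fun v hv => by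
    rw [← sub_eq_zero, ← hA v hv]
    generalize s • v = u, corr x y c d • v = v'
    module
  have hB' : ∀ v, P v → corr y w d e • v = (a - b) • t • v := fun v hv => by
    rw [← sub_eq_zero, ← hB v hv]
    generalize t • v = u, corr y w d e • v = v'
    module
  have hb : s • t • s • z = t • s • t • z := by
    have := congrArg (· • z) h.braid
    simpa only [mul_smul] using this
  rw [← h.corr_braid_smul z hx hy hw]
  have e1 : corr x y c d • corr y w d e • corr x y c d • z =
      ((b - a) * (a - b) * (b - a)) • s • t • s • z := by
    rw [hA' _ (hPB _ (hPA _ hz)), hB' _ (hPA _ hz), hA' _ hz]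
    simp only [sc]
    rw [smul_smul, smul_smul]
  have e2 : corr y w d e • corr x y c d • corr y w d e • z =
      ((a - b) * (b - a) * (a - b)) • t • s • t • z := by
    rw [hB' _ (hPA _ (hPB _ hz)), hA' _ (hPB _ hz), hB' _ hz]
    simp only [sc]
    rw [smul_smul, smul_smul]
  rw [e1, e2, hb]
  generalize t • s • t • z = v
  module

end IsStrandTriple

end Strands

end HeckeClifford

namespace HeckeClifford

/-! ### Arithmetic of residues in characteristic p. -/

section Residues

variable {F : Type*} [Field F] {p : ℕ} [CharP F p]

include p in
theorem two_ne_zero_of_char_ne_two (hp : p ≠ 2) : (2 : F) ≠ 0 := by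
  intro h
  have h' : ((2 : ℕ) : F) = 0 := by exact_mod_cast h
  rw [CharP.cast_eq_zero_iff F p] at h'
  rcases (Nat.dvd_prime Nat.prime_two).1 h' with h1 | h1
  · exact CharP.char_ne_one F p h1
  · exact hp h1

theorem mem_I_iff {i : ℕ} : i ∈ I p ↔ p = 0 ∨ i ≤ (p - 1) / 2 := Iff.rfl

include F in
theorem char_eq_zero_or_odd (hp : p ≠ 2) : p = 0 ∨ (3 ≤ p ∧ p % 2 = 1) := by
  rcases CharP.char_is_prime_or_zero F p with h | h
  · have := h.eq_two_or_odd
    have := h.two_le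
    omega
  · exact Or.inl h

theorem natCast_eq_zero_of_lt {m : ℕ} (hm : (m : F) = 0) (h : p = 0 ∨ m < p) : m = 0 := by
  rw [CharP.cast_eq_zero_iff F p] at hm
  rcases h with rfl | h
  · exact Nat.zero_dvd.1 hm
  · exact Nat.eq_zero_of_dvd_of_lt hm h

theorem natCast_eq_zero_of_lt_two_mul {m : ℕ} (hm : (m : F) = 0) (h : p = 0 ∨ m < 2 * p) :
    m = 0 ∨ m = p := by
  rw [CharP.cast_eq_zero_iff F p] at hm
  rcases h with rfl | h
  · exact Or.inl (Nat.zero_dvd.1 hm)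
  · obtain ⟨k, rfl⟩ := hm
    have hk : k < 2 := by
      by_contra! hk
      nlinarith
    interval_cases k <;> simp

theorem natCast_inj_of_lt {i j : ℕ} (h : (i : F) = j) (hi : p = 0 ∨ i < p) (hj : p = 0 ∨ j < p) :
    i = j := by
  rcases le_total i j with hij | hij
  · have := natCast_eq_zero_of_lt (F := F) (p := p) (m := j - i)
      (by rw [Nat.cast_sub hij, h, sub_self]) (by omega)
    omega
  · have := natCast_eq_zero_of_lt (F := F) (p := p) (m := i - j)
      (by rw [Nat.cast_sub hij, h, sub_self]) (by omega)
    omega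

theorem eq_zero_of_q_eq_zero (hp : p ≠ 2) {i : ℕ} (hi : i ∈ I p) (h : q F i = 0) : i = 0 := by
  have hc := char_eq_zero_or_odd (F := F) hp
  rw [mem_I_iff] at hi
  rcases mul_eq_zero.1 h with h | h
  · exact natCast_eq_zero_of_lt h (by omega)
  · have := natCast_eq_zero_of_lt (F := F) (p := p) (m := i + 1) (by exact_mod_cast h) (by omega)
    omega

theorem eq_or_adjacent_of_q (hp : p ≠ 2) {i j : ℕ} (hi : i ∈ I p) (hj : j ∈ I p)
    (h : (q F i - q F j) ^ 2 = 2 * (q F i + q F j)) : i = j ∨ i = j + 1 ∨ i + 1 = j := by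
  have hc := char_eq_zero_or_odd (F := F) hp
  rw [mem_I_iff] at hi hj
  -- With u = i - j and v = i + j + 1, q(i) - q(j) = uv and 2(q(i) + q(j)) = u² + v² - 1, so the
  -- equation reads (1 - u²)(v² - 1) = 0.
  have h1 : (((j + 1 : ℕ) : F) - i) * (((i + 1 : ℕ) : F) - j) * ((i + j : ℕ) : F) *
      ((i + j + 2 : ℕ) : F) = 0 := by
    unfold q at h
    push_cast
    linear_combination -h
  rcases mul_eq_zero.1 h1 with h1 | h1
  · rcases mul_eq_zero.1 h1 with h1 | h1
    · rcases mul_eq_zero.1 h1 with h1 | h1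
      · have := natCast_inj_of_lt (sub_eq_zero.1 h1) (by omega) (by omega)
        omega
      · have := natCast_inj_of_lt (sub_eq_zero.1 h1) (by omega) (by omega)
        omega
    · have := natCast_eq_zero_of_lt h1 (by omega)
      omega
  -- The sum i + j + 2 can reach p + 1. The value p occurs only for the residues (p - 1)/2 and (p -
  -- 3)/2, which are adjacent.
  · have := natCast_eq_zero_of_lt_two_mul h1 (by omega)
    omega

theorem eq_of_two_q_add_six_q (hp : p ≠ 2) {i j : ℕ} (hi : i ∈ I p) (hj : j ∈ I p) (hi0 : i ≠ 0)
    (hij : i = j + 1 ∨ i + 1 = j) (h : 2 * q F i + 6 * q F j = 0) :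
    3 ≤ p ∧ i = (p - 3) / 2 ∧ j = (p - 1) / 2 := by
  have hc := char_eq_zero_or_odd (F := F) hp
  have h2 : (2 : F) ≠ 0 := two_ne_zero_of_char_ne_two hp
  rw [mem_I_iff] at hi hj
  unfold q at h
  rcases hij with rfl | rfl
  · have h1 : 2 * 2 * ((j + 1 : ℕ) : F) * ((2 * j + 1 : ℕ) : F) = 0 := by
      push_cast at h ⊢
      linear_combination h
    simp only [mul_eq_zero, h2, or_false, false_or] at h1
    rcases h1 with h1 | h1
    · have := natCast_eq_zero_of_lt h1 (by omega)
      omega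
    · have := natCast_eq_zero_of_lt h1 (by omega)
      omega
  · have h1 : 2 * 2 * ((i + 1 : ℕ) : F) * ((2 * i + 3 : ℕ) : F) = 0 := by
      push_cast at h ⊢
      linear_combination h
    simp only [mul_eq_zero, h2, or_false, false_or] at h1
    rcases h1 with h1 | h1
    · have := natCast_eq_zero_of_lt h1 (by omega)
      omega
    -- Here 2i + 3 = p is possible, and it is the exceptional case.
    · have := natCast_eq_zero_of_lt_two_mul h1 (by omega)
      omega

end Residues

end HeckeClifford

namespace HeckeClifford

theorem lt_of_add_two_lt {k n : ℕ} (h : k + 2 < n) : k < n :=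
  Nat.lt_of_succ_lt (Nat.lt_of_succ_lt h)

/-! ### The generators of the algebra satisfy the strand relations. -/

section Generators

variable (F : Type*) [Field F] {n : ℕ}

/-- The element `s_k` of the affine Hecke-Clifford algebra. -/
noncomputable def s (k : ℕ) (h : k + 1 < n) : Alg F n := gen F (Gen.s k h)

/-- The element `c_k` of the affine Hecke-Clifford algebra. -/
noncomputable def c (k : Fin n) : Alg F n := gen F (Gen.c k)

/-- The quotient map from the free algebra onto the affine Hecke-Clifford algebra. -/
noncomputable def mk : FreeAlgebra F (Gen n) →ₐ[F] Alg F n := RingQuot.mkAlgHom F (Rel F (n := n))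

variable {F} in
theorem mk_rel {a b : FreeAlgebra F (Gen n)} (h : Rel F a b) : mk F a = mk F b :=
  RingQuot.mkAlgHom_rel F h

theorem mk_s (k : ℕ) (h : k + 1 < n) : mk F (fs F k h) = s F k h := rfl
theorem mk_x (k : Fin n) : mk F (fx F k) = x F k := rfl
theorem mk_c (k : Fin n) : mk F (fc F k) = c F k := rfl

theorem x_comm (k l : Fin n) : x F k * x F l = x F l * x F k := by
  simpa only [map_mul, mk_x] using mk_rel (Rel.x_comm k l)

theorem c_sq (k : Fin n) : c F k * c F k = 1 := by
  simpa only [map_mul, map_one, mk_c] using mk_rel (Rel.c_sq k)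

theorem c_anti {k l : Fin n} (h : k ≠ l) : c F k * c F l = -(c F l * c F k) := by
  simpa only [map_mul, map_neg, mk_c] using mk_rel (Rel.c_anti k l h)

theorem x_c_same (k : Fin n) : x F k * c F k = -(c F k * x F k) := by
  simpa only [map_mul, map_neg, mk_c, mk_x] using mk_rel (Rel.x_c_same k)

theorem x_c {k l : Fin n} (h : k ≠ l) : x F k * c F l = c F l * x F k := by
  simpa only [map_mul, mk_c, mk_x] using mk_rel (Rel.x_c k l h)

theorem s_x_far (k : ℕ) (h : k + 1 < n) (j : Fin n) (h₁ : (j : ℕ) ≠ k) (h₂ : (j : ℕ) ≠ k + 1) :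
    s F k h * x F j = x F j * s F k h := by
  simpa only [map_mul, mk_s, mk_x] using mk_rel (Rel.s_x_far k h j h₁ h₂)

theorem s_c_far (k : ℕ) (h : k + 1 < n) (j : Fin n) (h₁ : (j : ℕ) ≠ k) (h₂ : (j : ℕ) ≠ k + 1) :
    s F k h * c F j = c F j * s F k h := by
  simpa only [map_mul, mk_s, mk_c] using mk_rel (Rel.s_c_far k h j h₁ h₂)

theorem isCliffordPair {k l : Fin n} (h : k ≠ l) :
    IsCliffordPair (x F k) (x F l) (c F k) (c F l) :=
  ⟨x_comm F l k, c_sq F k, c_sq F l, c_anti F h.symm, x_c_same F k, x_c_same F l, x_c F h,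
    x_c F h.symm⟩

theorem isStrandPair (k : ℕ) (h : k + 1 < n) :
    IsStrandPair (s F k h) (x F ⟨k, Nat.lt_of_succ_lt h⟩) (x F ⟨k + 1, h⟩)
      (c F ⟨k, Nat.lt_of_succ_lt h⟩)
      (c F ⟨k + 1, h⟩) where
  toIsCliffordPair := isCliffordPair F (by simp)
  ss := by simpa only [map_mul, map_one, mk_s] using mk_rel (Rel.s_sq k h)
  sx := by
    simpa only [map_mul, map_sub, map_add, map_one, mk_s, mk_x, mk_c] using mk_rel (Rel.s_x k h)
  sc := by simpa only [map_mul, mk_s, mk_c] using mk_rel (Rel.s_c_left k h)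
  sd := by simpa only [map_mul, mk_s, mk_c] using mk_rel (Rel.s_c_right k h)

theorem isStrandTriple (k : ℕ) (h : k + 2 < n) :
    IsStrandTriple (s F k (Nat.lt_of_succ_lt h)) (s F (k + 1) h)
      (x F ⟨k, lt_of_add_two_lt h⟩)
      (x F ⟨k + 1, Nat.lt_of_succ_lt h⟩) (x F ⟨k + 2, h⟩)
      (c F ⟨k, lt_of_add_two_lt h⟩) (c F ⟨k + 1, Nat.lt_of_succ_lt h⟩)
      (c F ⟨k + 2, h⟩) where
  left := isStrandPair F k _
  right := isStrandPair F (k + 1) h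
  braid := by simpa only [map_mul, mk_s] using mk_rel (Rel.s_braid k h)
  tx := s_x_far F _ _ _ (by simp) (by simp; omega)
  tc := s_c_far F _ _ _ (by simp) (by simp; omega)
  wx := x_comm F _ _
  ec := c_anti F (by simp)
  xe := x_c F (by simp)
  wc := x_c F (by simp)

end Generators

/-! ### Joint eigenvectors and their weights. -/

section Weights

variable {F : Type*} [Field F] {p n : ℕ} {M : Type*} [AddCommGroup M] [Module F M]
  [Module (Alg F n) M] [IsScalarTower F (Alg F n) M]

theorem xSq_apply (k : Fin n) (v : M) : xSq (F := F) M k v = x F k • x F k • v := by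
  rw [← mul_smul, ← sq]
  rfl

/-- A joint eigenvector of the `x_k ^ 2` with eigenvalues `q (i_k)`. -/
def IsEigen (F : Type*) [Field F] {n : ℕ} {M : Type*} [AddCommGroup M] [Module F M]
    [Module (Alg F n) M] (i : Fin n → ℕ) (z : M) : Prop :=
  ∀ k, x F k • x F k • z = q F (i k) • z

theorem maxGenEigenspace_xSq {k : Fin n} (hss : (xSq (F := F) M k).IsSemisimple) (a : F) :
    (xSq (F := F) M k).maxGenEigenspace a = (xSq (F := F) M k).eigenspace a :=
  (hss.isFinitelySemisimple).maxGenEigenspace_eq_eigenspace a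

theorem isWeight_iff (hss : ∀ k : Fin n, (xSq (F := F) M k).IsSemisimple) (i : Fin n → ℕ) :
    IsWeight (F := F) p M i ↔ (∀ k, i k ∈ I p) ∧ ∃ z : M, z ≠ 0 ∧ IsEigen F i z := by
  simp only [IsWeight, Submodule.ne_bot_iff, weightSpace, Submodule.mem_iInf,
    maxGenEigenspace_xSq (hss _), Module.End.mem_eigenspace_iff, xSq_apply, IsEigen]
  simp only [and_comm]

theorem eq_of_xSq_sub_sq {k : Fin n} (hss : (xSq (F := F) M k).IsSemisimple) {a : F} (v : M)
    (h : x F k • x F k • (x F k • x F k • v - a • v) = a • (x F k • x F k • v - a • v)) :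
    x F k • x F k • v = a • v := by
  have h1 : v ∈ (xSq (F := F) M k).maxGenEigenspace a := by
    rw [Module.End.mem_maxGenEigenspace]
    -- The hypothesis says (x_k² - a)²v = 0.
    refine ⟨2, ?_⟩
    simp only [sq, Module.End.mul_apply, LinearMap.sub_apply, LinearMap.smul_apply,
      Module.End.one_apply, xSq_apply, h, sub_self]
  rw [maxGenEigenspace_xSq hss, Module.End.mem_eigenspace_iff, xSq_apply] at h1
  exact h1

omit [Module F M] [IsScalarTower F (Alg F n) M] in
theorem smul_smul_comm_of_sq_comm {r u : Alg F n} (h : r * r * u = u * (r * r)) (v : M) :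
    r • r • u • v = u • r • r • v := by
  simpa only [mul_smul] using congrArg (· • v) h

theorem IsEigen.smul {i : Fin n → ℕ} {z : M} (hz : IsEigen F i z) {u : Alg F n}
    (hu : ∀ k, x F k * x F k * u = u * (x F k * x F k)) : IsEigen F i (u • z) := fun k => by
  rw [smul_smul_comm_of_sq_comm (hu k), hz k, smul_comm]

theorem xx_x (k l : Fin n) : x F k * x F k * x F l = x F l * (x F k * x F k) := by
  rw [mul_assoc, x_comm F k l, ← mul_assoc, x_comm F k l, mul_assoc]

theorem xx_c (k l : Fin n) : x F k * x F k * c F l = c F l * (x F k * x F k) := by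
  rcases eq_or_ne k l with rfl | h
  · rw [mul_assoc, x_c_same, mul_neg, ← mul_assoc, x_c_same, neg_mul, neg_neg, mul_assoc]
  · rw [mul_assoc, x_c F h, ← mul_assoc, x_c F h, mul_assoc]

theorem xx_s {k : ℕ} (h : k + 1 < n) (j : Fin n) (h₁ : (j : ℕ) ≠ k) (h₂ : (j : ℕ) ≠ k + 1) :
    x F j * x F j * s F k h = s F k h * (x F j * x F j) := by
  rw [mul_assoc, ← s_x_far F k h j h₁ h₂, ← mul_assoc, ← s_x_far F k h j h₁ h₂, mul_assoc]

theorem commute_xx_corr (j k l : Fin n) :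
    Commute (x F j * x F j) (corr (x F k) (x F l) (c F k) (c F l)) := by
  have hx (k : Fin n) : Commute (x F j * x F j) (x F k) := xx_x j k
  have hc (k : Fin n) : Commute (x F j * x F j) (c F k) := xx_c j k
  exact ((hx k).add_right (hx l)).add_right
    (((hc k).mul_right (hc l)).mul_right ((hx k).sub_right (hx l)))

theorem IsEigen.corr_smul {i : Fin n → ℕ} {z : M} (hz : IsEigen F i z) (k l : Fin n) :
    IsEigen F i (corr (x F k) (x F l) (c F k) (c F l) • z) :=
  hz.smul fun j => commute_xx_corr j k l

/-- The action of the intertwining element of the strands `k` and `k + 1` on a joint eigenvector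
of weight `i`. -/
noncomputable def intertwine (i : Fin n → ℕ) (k : ℕ) (h : k + 1 < n) (z : M) : M :=
  (q F (i ⟨k, Nat.lt_of_succ_lt h⟩) - q F (i ⟨k + 1, h⟩)) • s F k h • z +
    corr (x F ⟨k, Nat.lt_of_succ_lt h⟩) (x F ⟨k + 1, h⟩)
      (c F ⟨k, Nat.lt_of_succ_lt h⟩) (c F ⟨k + 1, h⟩) • z

theorem IsEigen.intertwine {i : Fin n → ℕ} {z : M} (hz : IsEigen F i z) (k : ℕ) (h : k + 1 < n) :
    IsEigen F (i ∘ Equiv.swap (⟨k, Nat.lt_of_succ_lt h⟩ : Fin n) ⟨k + 1, h⟩)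
      (intertwine (F := F) i k h z) := by
  intro j
  obtain ⟨h1, h2⟩ := (isStrandPair F k h).eigen_intertwiner (hz _) (hz _)
  by_cases hj : j = ⟨k, Nat.lt_of_succ_lt h⟩
  · subst hj
    rw [Function.comp_apply, Equiv.swap_apply_left]
    exact h1
  by_cases hj' : j = ⟨k + 1, h⟩
  · subst hj'
    rw [Function.comp_apply, Equiv.swap_apply_right]
    exact h2
  rw [Function.comp_apply, Equiv.swap_apply_of_ne_of_ne hj hj', HeckeClifford.intertwine, smul_add,
    smul_add, (hz.corr_smul _ _) j, smul_comm (x F j) (_ : F), smul_comm (x F j) (_ : F),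
    smul_smul_comm_of_sq_comm (xx_s h j (fun e => hj (Fin.ext e)) (fun e => hj' (Fin.ext e))), hz j,
    smul_comm (s F k h) (_ : F), smul_add,
    smul_comm (q F (i j)) (q F _ - q F _) (s F k h • z)]

theorem IsWeight.swap (hss : ∀ k : Fin n, (xSq (F := F) M k).IsSemisimple) {i : Fin n → ℕ}
    (hi : ∀ k, i k ∈ I p) {z : M} (hz : IsEigen F i z) (k : ℕ) (h : k + 1 < n)
    (h0 : HeckeClifford.intertwine (F := F) i k h z ≠ 0) :
    IsWeight (F := F) p M (i ∘ Equiv.swap (⟨k, Nat.lt_of_succ_lt h⟩ : Fin n) ⟨k + 1, h⟩) :=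
  (isWeight_iff hss _).2 ⟨fun _ => hi _, _, h0, hz.intertwine k h⟩

variable [CharP F p]

theorem adjacent_of_intertwine_eq_zero (hp : p ≠ 2) {i : Fin n → ℕ} (hi : ∀ k, i k ∈ I p) {z : M}
    (hz0 : z ≠ 0) (hz : IsEigen F i z) (k : ℕ) (h : k + 1 < n)
    (h0 : HeckeClifford.intertwine (F := F) i k h z = 0) :
    i ⟨k, Nat.lt_of_succ_lt h⟩ = i ⟨k + 1, h⟩ ∨ i ⟨k, Nat.lt_of_succ_lt h⟩ = i ⟨k + 1, h⟩ + 1 ∨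
      i ⟨k, Nat.lt_of_succ_lt h⟩ + 1 = i ⟨k + 1, h⟩ :=
  eq_or_adjacent_of_q (F := F) hp (hi _) (hi _)
    ((isStrandPair F k h).eq_of_intertwiner_eq_zero hz0 (hz _) (hz _) h0)

omit [CharP F p] in
theorem IsEigen.corr_smul_eq_zero (hss : ∀ k : Fin n, (xSq (F := F) M k).IsSemisimple)
    {i : Fin n → ℕ} {z : M} (hz : IsEigen F i z) (k : ℕ) (h : k + 1 < n)
    (hk : i ⟨k, Nat.lt_of_succ_lt h⟩ = i ⟨k + 1, h⟩) :
    corr (x F ⟨k, Nat.lt_of_succ_lt h⟩) (x F ⟨k + 1, h⟩)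
      (c F ⟨k, Nat.lt_of_succ_lt h⟩) (c F ⟨k + 1, h⟩) • z = 0 :=
  (isStrandPair F k h).corr_smul_eq_zero (a := q F (i ⟨k + 1, h⟩))
    (fun v hv => eq_of_xSq_sub_sq (hss _) v hv) (by rw [hz, hk]) (hz _)

omit [IsScalarTower F (Alg F n) M] in
theorem IsEigen.eq_zero_of_corr_smul (hp : p ≠ 2) {i : Fin n → ℕ} (hi : ∀ k, i k ∈ I p) {z : M}
    (hz0 : z ≠ 0) (hz : IsEigen F i z) {k l : Fin n} (hkl : k ≠ l) (h : i k = i l)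
    (h0 : corr (x F k) (x F l) (c F k) (c F l) • z = 0) : i k = 0 := by
  have h1 := (isCliffordPair F hkl).corr_corr_smul_of_eigen (hz k) (hz l)
  rw [h0, smul_zero, eq_comm, smul_eq_zero, or_iff_left hz0, h, ← two_mul, mul_eq_zero,
    mul_eq_zero] at h1
  have h2 : (2 : F) ≠ 0 := two_ne_zero_of_char_ne_two hp
  rw [h]
  exact eq_zero_of_q_eq_zero hp (hi l) ((h1.resolve_left h2).resolve_left h2)

theorem IsWeight.eq_zero_of_eq (hp : p ≠ 2) (hss : ∀ k : Fin n, (xSq (F := F) M k).IsSemisimple)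
    {i : Fin n → ℕ} (hi : IsWeight (F := F) p M i) (k : ℕ) (h : k + 1 < n)
    (hk : i ⟨k, Nat.lt_of_succ_lt h⟩ = i ⟨k + 1, h⟩) : i ⟨k, Nat.lt_of_succ_lt h⟩ = 0 := by
  obtain ⟨hI, z, hz0, hz⟩ := (isWeight_iff hss i).1 hi
  exact hz.eq_zero_of_corr_smul hp hI hz0 (by simp) hk (hz.corr_smul_eq_zero hss k h hk)

theorem IsWeight.not_three_eq (hp : p ≠ 2) (hss : ∀ k : Fin n, (xSq (F := F) M k).IsSemisimple)
    {i : Fin n → ℕ} (hi : IsWeight (F := F) p M i) (k : ℕ) (h : k + 2 < n)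
    (h₁ : i ⟨k, lt_of_add_two_lt h⟩ = i ⟨k + 1, Nat.lt_of_succ_lt h⟩)
    (h₂ : i ⟨k + 1, Nat.lt_of_succ_lt h⟩ = i ⟨k + 2, h⟩) : False := by
  obtain ⟨hI, z, hz0, hz⟩ := (isWeight_iff hss i).1 hi
  have h2 : (2 : F) ≠ 0 := two_ne_zero_of_char_ne_two hp
  have T := isStrandTriple F k h
  have hc := hz.corr_smul_eq_zero hss (k + 1) h h₂
  obtain ⟨e1, e2⟩ := T.right.eigen_s_smul (a := q F (i ⟨k + 1, Nat.lt_of_succ_lt h⟩)) (hz _)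
    (by rw [hz, h₂]) hc
  -- The correction term vanishes on z, so swapping the last two strands preserves the eigenvalues.
  have hz' : IsEigen F i (s F (k + 1) h • z) := by
    intro j
    by_cases hj : j = ⟨k + 1, Nat.lt_of_succ_lt h⟩
    · rw [hj]; exact e1
    by_cases hj' : j = ⟨k + 2, h⟩
    · rw [hj', ← h₂]; exact e2
    rw [smul_smul_comm_of_sq_comm (xx_s h j (fun e => hj (Fin.ext e)) (fun e => hj' (Fin.ext e))),
      hz j, smul_comm]
  exact hz0 (T.eq_zero_of_smul_eq h2
    (T.left.smul_eq_of_corr_smul_eq_zero h2 (hz.corr_smul_eq_zero hss k _ h₁))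
    (T.right.smul_eq_of_corr_smul_eq_zero h2 hc)
    (T.left.smul_eq_of_corr_smul_eq_zero h2 (hz'.corr_smul_eq_zero hss k _ h₁)))

theorem IsWeight.eq_of_eq_add_two (hp : p ≠ 2)
    (hss : ∀ k : Fin n, (xSq (F := F) M k).IsSemisimple)
    {i : Fin n → ℕ} (hi : IsWeight (F := F) p M i) (k : ℕ) (h : k + 2 < n)
    (hk : i ⟨k, lt_of_add_two_lt h⟩ = i ⟨k + 2, h⟩)
    (h0 : i ⟨k, lt_of_add_two_lt h⟩ ≠ 0) :
    3 ≤ p ∧ i ⟨k, lt_of_add_two_lt h⟩ = (p - 3) / 2 ∧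
      i ⟨k + 1, Nat.lt_of_succ_lt h⟩ = (p - 1) / 2 := by
  obtain ⟨hI, z, hz0, hz⟩ := (isWeight_iff hss i).1 hi
  have h1 : i ⟨k, lt_of_add_two_lt h⟩ ≠ i ⟨k + 1, Nat.lt_of_succ_lt h⟩ := fun e =>
    h0 (hi.eq_zero_of_eq hp hss k _ e)
  -- A nonzero image would have weight (…, i_{k+1}, i_k, i_{k+2}, …), whose last two displayed
  -- entries are equal and nonzero. The case of `hB` is symmetric.
  have hA : ∀ v : M, IsEigen F i v →
      HeckeClifford.intertwine (F := F) i k (Nat.lt_of_succ_lt h) v = 0 := by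
    intro v hv
    by_contra hne
    have hw := IsWeight.swap hss hI hv k _ hne
    have h3 : Equiv.swap (⟨k, lt_of_add_two_lt h⟩ : Fin n) ⟨k + 1, Nat.lt_of_succ_lt h⟩ ⟨k + 2, h⟩ =
        ⟨k + 2, h⟩ :=
      Equiv.swap_apply_of_ne_of_ne (by simp) (by simp)
    have h4 := hw.eq_zero_of_eq hp hss (k + 1) h (by
      simp only [Function.comp_apply, Equiv.swap_apply_right, h3, hk])
    rw [Function.comp_apply, Equiv.swap_apply_right] at h4
    exact h0 h4
  have hB : ∀ v : M, IsEigen F i v →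
      HeckeClifford.intertwine (F := F) i (k + 1) h v = 0 := by
    intro v hv
    by_contra hne
    have hw := IsWeight.swap hss hI hv (k + 1) _ hne
    have h3 : Equiv.swap (⟨k + 1, Nat.lt_of_succ_lt h⟩ : Fin n) ⟨k + 2, h⟩ ⟨k, lt_of_add_two_lt h⟩ =
        ⟨k, lt_of_add_two_lt h⟩ :=
      Equiv.swap_apply_of_ne_of_ne (by simp) (by simp)
    have h4 := hw.eq_zero_of_eq hp hss k (Nat.lt_of_succ_lt h) (by
      simp only [Function.comp_apply, Equiv.swap_apply_left, h3, hk])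
    rw [Function.comp_apply, h3] at h4
    exact h0 h4
  have hadj := (adjacent_of_intertwine_eq_zero hp hI hz0 hz k (Nat.lt_of_succ_lt h)
    (hA z hz)).resolve_left h1
  have T := isStrandTriple F k h
  have hC := T.corr_outer_smul_eq_zero (P := IsEigen F i) (fun v hv => hv.corr_smul _ _)
    (fun v hv => hv.corr_smul _ _) hA
    (fun v hv => by simpa only [HeckeClifford.intertwine, ← hk] using hB v hv) hz (hz _) (hz _)
    (by rw [hz, hk])
  rcases smul_eq_zero.1 hC with hC | hC
  · exact eq_of_two_q_add_six_q hp (hI _) (hI _) h0 hadj hC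
  · exact absurd (hz.eq_zero_of_corr_smul hp hI hz0 (by simp) hk hC) h0

end Weights

end HeckeClifford

/-! ### The proposition. -/

theorem mainTheorem10 {F : Type*} [Field F] [IsAlgClosed F] (p : ℕ) [CharP F p] (hp : p ≠ 2)
    (n : ℕ) {M : Type*} [AddCommGroup M] [Module F M] [Module (HeckeClifford.Alg F n) M]
    [IsScalarTower F (HeckeClifford.Alg F n) M]
    (ℳ : ZMod 2 → Submodule F M) [DirectSum.Decomposition ℳ]
    [SetLike.GradedSMul (HeckeClifford.part F n) ℳ]
    (hint : HeckeClifford.IsIntegral (F := F) p (n := n) M)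
    (hirr : HeckeClifford.IsIrreducible F n ℳ)
    (hss : ∀ k : Fin n, (HeckeClifford.xSq (F := F) M k).IsSemisimple)
    (i : Fin n → ℕ) (hi : HeckeClifford.IsWeight (F := F) p M i) :
    (∀ (k : ℕ) (h : k + 1 < n),
      i ⟨k, by omega⟩ ≠ i ⟨k + 1, h⟩ + 1 → i ⟨k, by omega⟩ + 1 ≠ i ⟨k + 1, h⟩ →
        HeckeClifford.IsWeight (F := F) p M
          (i ∘ Equiv.swap (⟨k, by omega⟩ : Fin n) ⟨k + 1, h⟩)) ∧
    (∀ (k : ℕ) (h : k + 1 < n),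
      i ⟨k, by omega⟩ = i ⟨k + 1, h⟩ → i ⟨k, by omega⟩ = 0 ∧ i ⟨k + 1, h⟩ = 0) ∧
    (¬ ∃ (k : ℕ) (h : k + 2 < n),
      i ⟨k, by omega⟩ = i ⟨k + 1, by omega⟩ ∧ i ⟨k + 1, by omega⟩ = i ⟨k + 2, h⟩) ∧
    (∀ (k : ℕ) (h : k + 2 < n), i ⟨k, by omega⟩ = i ⟨k + 2, h⟩ →
      (p = 0 → i ⟨k, by omega⟩ = 0 ∧ i ⟨k + 2, h⟩ = 0) ∧
      (3 ≤ p →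
        (i ⟨k, by omega⟩ = (p - 3) / 2 ∧ i ⟨k + 2, h⟩ = (p - 3) / 2 ∧
          i ⟨k + 1, by omega⟩ = (p - 1) / 2) ∨
        (i ⟨k, by omega⟩ = 0 ∧ i ⟨k + 2, h⟩ = 0))) := by
  refine ⟨fun k h h₁ h₂ => ?_, fun k h hk => ?_, ?_, fun k h hk => ?_⟩
  · obtain ⟨hI, z, hz0, hz⟩ := (HeckeClifford.isWeight_iff hss i).1 hi
    by_cases h0 : HeckeClifford.intertwine (F := F) i k h z = 0
    -- With adjacency excluded, a vanishing intertwiner means equal residues, and the swap then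
    -- fixes the weight.
    · have hk : i ⟨k, by omega⟩ = i ⟨k + 1, h⟩ := by
        have := HeckeClifford.adjacent_of_intertwine_eq_zero hp hI hz0 hz k h h0
        tauto
      rwa [Equiv.comp_swap_eq_update, hk, Function.update_eq_self, ← hk, Function.update_eq_self]
    · exact HeckeClifford.IsWeight.swap hss hI hz k h h0
  · have := hi.eq_zero_of_eq hp hss k h hk
    exact ⟨this, hk ▸ this⟩
  · rintro ⟨k, h, h₁, h₂⟩
    exact hi.not_three_eq hp hss k h h₁ h₂
  · by_cases h0 : i ⟨k, by omega⟩ = 0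
    · exact ⟨fun _ => ⟨h0, hk ▸ h0⟩, fun _ => Or.inr ⟨h0, hk ▸ h0⟩⟩
    · obtain ⟨h3, h4, h5⟩ := hi.eq_of_eq_add_two hp hss k h hk h0
      exact ⟨fun hp0 => by omega, fun _ => Or.inl ⟨h4, hk ▸ h4, h5⟩⟩
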